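/- Let $X$ be a complex Banach space and let $x=(x_n)_{n\ge 0}\in\ell^\infty(\mathbb{Z}_+;X)$ satisfy $$\sup_{n\ge 0}\Big\|\sum_{k=0}^n x_k\Big\|<\infty .$$ For $\lambda\in\mathbb{C}$ with $|\lambda|>1$ put $G_x(\lambda)=\sum_{n=0}^\infty x_n\lambda^{-(n+1)}$. Let $\mathbb{T}$ be the unit circle, and suppose that $G_x$ admits a smooth boundary function $F_x\in C^\infty(\mathbb{T}\setminus\{1\};X)$, that is, one such that $$\lim_{r\to1+}\int_{-\pi}^{\pi}\psi(\theta)\,G_x(re^{i\theta})\,d\theta=\int_{-\pi}^{\pi}\psi(\theta)\,F_x(e^{i\theta})\,d\theta$$ for all $\psi\in C([-\pi,\pi])$ with $0\notin\operatorname{supp}\psi$. Write $F_x^{(j)}$ for the $j$-th derivative of $F_x$ along $\mathbb{T}\setminus\{1\}$ with respect to the circle variable, where $F'(z)=\lim_{w\to z,\,w\in\mathbb{T}}\frac{F(w)-F(z)}{w-z}$, so that $\frac{d}{d\theta}F(e^{i\theta})=ie^{i\theta}F'(e^{i\theta})$. Let $m\colon(0,\pi]\to(0,\infty)$ be a continuous,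 non-increasing function and assume that there exists $C>0$ such that, for all $j\ge0$, $$\|F_x^{(j)}(e^{i\theta})\|\le C\,j!\,|\theta|\,m(|\theta|)^{j+1},\qquad 0<|\theta|\le\pi .$$ Define $m_{\log}\colon(0,\pi]\to(0,\infty)$ by $$m_{\log}(\epsilon)=m(\epsilon)\log\Big(1+\frac{m(\epsilon)}{\epsilon}\Big).$$ This is a strictly decreasing bijection onto $[m_{\log}(\pi),\infty)$; let $m_{\log}^{-1}$ be its inverse. Then, for every $c\in(0,1)$, $$\|x_n\|=O\big(m_{\log}^{-1}(cn)\big),\qquad n\to\infty .$$ -/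

import Mathlib

open Filter Topology Asymptotics
open scoped Manifold ContDiff ENNReal

namespace DiscreteTauberian

noncomputable section

variable {X : Type*} [NormedAddCommGroup X] [NormedSpace ℂ X]

/-- The function `G_x(z) = ∑ x_n / z ^ (n + 1)`; for bounded `x` the series converges
absolutely for every `z` with `1 < |z|`, and only such `z` are used. -/
def genFun (x : ℕ → X) (z : ℂ) : X :=
  ∑' n : ℕ, (z ^ (n + 1))⁻¹ • x n

/-- `F` is a boundary function on the unit circle without the point `1` for a function `G` on the
exterior of the closed unit disc. The value of `F` at `1` plays no role.
The first clause says that `F` is locally integrable on the circle without `1`;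
in the second, the test functions are the continuous functions on `[-π, π]`
whose support does not contain `0`. -/
def IsBoundaryFunction (G : ℂ → X) (F : Circle → X) : Prop :=
  MeasureTheory.LocallyIntegrableOn (fun θ : ℝ => F (Circle.exp θ))
      {θ : ℝ | Circle.exp θ ≠ 1} ∧
    ∀ ψ : ℝ → ℂ, ContinuousOn ψ (Set.Icc (-Real.pi) Real.pi) →
      (0 : ℝ) ∉ closure {θ : ℝ | θ ∈ Set.Icc (-Real.pi) Real.pi ∧ ψ θ ≠ 0} →
      Tendsto
        (fun r : ℝ => ∫ θ in (-Real.pi)..Real.pi,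
          ψ θ • G ((r : ℂ) * Complex.exp ((θ : ℂ) * Complex.I)))
        (𝓝[>] 1)
        (𝓝 (∫ θ in (-Real.pi)..Real.pi, ψ θ • F (Circle.exp θ)))

/-- The derivative of `F` along the unit circle with respect to the variable `z` of the circle,
that is, the limit of `(F w - F z) / (w - z)` as `w` tends to `z` on the circle. In terms
of the angle, `d/dθ F(e^{iθ}) = i e^{iθ} F'(e^{iθ})`. -/
def circleDeriv (F : Circle → X) (z : Circle) : X :=
  (Complex.I * (z : ℂ))⁻¹ • deriv (fun t : ℝ => F (z * Circle.exp t)) 0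

/-- The derivative of order `j` of `F` along the unit circle. -/
def iteratedCircleDeriv (j : ℕ) (F : Circle → X) : Circle → X :=
  circleDeriv^[j] F

/-- The function `m_log(ε) = m(ε) log(1 + m(ε)/ε)`, used for `ε` in `(0, π]`. -/
def mLog (m : ℝ → ℝ) (ε : ℝ) : ℝ :=
  m ε * Real.log (1 + m ε / ε)

/-- The inverse of the function `m_log` on `(0, π]`. For `m` positive, continuous and
non-increasing, `m_log` maps `(0, π]` bijectively onto `[m_log(π), ∞)`, so that the inverse is
determined at all sufficiently large arguments. -/
def mLogInv (m : ℝ → ℝ) (t : ℝ) : ℝ :=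
  Function.invFunOn (mLog m) (Set.Ioc 0 Real.pi) t

end

end DiscreteTauberian

/-!
The coefficients are split by frequency at a scale `δ`. Let `φ = β (· / δ)` with `β` a smooth bump
function, equal to `1` on `[-1, 1]` and to `0` off `[-2, 2]`. For `r > 1`, `2π r ^ (-(n + 1)) x n`
is the integral of `e ^ (i (n + 1) θ) G_x (r e ^ (iθ))` over the circle, and the weights `φ` and
`1 - φ` divide it into a low and a high frequency part.

* Low frequencies. By summation by parts and the boundedness of the partial sums of `x`, this part
  is at most a constant times the supremum and the variation of the Fourier coefficients of `φ`.
  These coefficients are `δ` times the values of a fixed Schwartz function at points with spacing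
  `δ / (2π)`, so that both are `O(δ)`, uniformly in `n` and `r`
  (`exists_bound_fourier_dilate`, `norm_integral_dilate_smul_genFun_le`).
* High frequencies. As `r → 1+`, this part tends to the integral of
  `(1 - φ) e ^ (i (n + 1) θ) F (e ^ (iθ))`. Integrating by parts `J` times in the circle variable,
  and never differentiating `1 - φ` more than once, gives with `μ = m δ` the bound
  `O(δ) ∑_{j < J} j! (μ / n) ^ (j + 1) + O(1) μ J! (μ / n) ^ J` (`norm_integral_cutoff_le`).
  Here the factor `δ` in the sum comes from the factor `|θ|` in the hypothesis on `F`, because the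
  derivative of `φ` lives on `δ ≤ |θ| ≤ 2δ`. For `J = ⌊n / μ⌋` the sum is at most `1`.

With `δ = m_log⁻¹ (c n)`, that is `μ log (1 + μ / δ) = c n`, Stirling's bound makes the remainder
about `μ (n / μ) e ^ (-n / μ)`, where `e ^ (-c n / μ) = (1 + μ / δ)⁻¹ ≤ δ / μ`, and the polynomial
factor `n / μ` is absorbed by `e ^ (-(1 - c) n / μ)` (`remainder_le`). Thus `‖x n‖ = O(δ)`.
-/

namespace DiscreteTauberian

open MeasureTheory Set
open scoped FourierTransform Real

/-! ### Fourier coefficients of dilated test functions -/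

theorem exists_cutoff : ∃ β : ℝ → ℝ, ContDiff ℝ ∞ β ∧ HasCompactSupport β ∧
    (∀ u, |u| ≤ 1 → β u = 1) ∧ (∀ u, 2 ≤ |u| → β u = 0) ∧ ∀ u, β u ∈ Icc (0 : ℝ) 1 := by
  let b : ContDiffBump (0 : ℝ) := ⟨1, 2, one_pos, one_lt_two⟩
  refine ⟨b, b.contDiff, b.hasCompactSupport, fun u hu => ?_, fun u hu => ?_, fun u => ?_⟩
  · exact b.one_of_mem_closedBall (by simpa [b] using hu)
  · exact b.zero_of_le_dist (by simpa [b] using hu)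
  · exact ⟨b.nonneg, b.le_one⟩

/-- The variation of a function along an arithmetic progression of step `1` is at most the `L¹` norm
of its derivative. -/
theorem sum_norm_sub_le_integral_norm_deriv {h h' : ℝ → ℂ} (hd : ∀ t, HasDerivAt h (h' t) t)
    (hc : Continuous h') (hi : Integrable h') (a : ℝ) (M : ℕ) :
    ∑ k ∈ Finset.range M, ‖h (a - k) - h (a - k - 1)‖ ≤ ∫ t, ‖h' t‖ := by
  have hint : ∀ u v : ℝ, IntervalIntegrable (fun t => ‖h' t‖) volume u v := fun u v =>
    hc.norm.intervalIntegrable u v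
  calc
    ∑ k ∈ Finset.range M, ‖h (a - k) - h (a - k - 1)‖
        ≤ ∑ k ∈ Finset.range M, -∫ t in (a - k)..(a - (k + 1 : ℕ)), ‖h' t‖ := by
      refine Finset.sum_le_sum fun k _ => ?_
      rw [← intervalIntegral.integral_symm, Nat.cast_succ, ← sub_sub,
        ← intervalIntegral.integral_eq_sub_of_hasDerivAt (fun t _ => hd t)
          (hc.intervalIntegrable _ _)]
      exact intervalIntegral.norm_integral_le_integral_norm (by linarith)
    _ = ∫ t in (a - M)..a, ‖h' t‖ := by
      rw [Finset.sum_neg_distrib,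
        intervalIntegral.sum_integral_adjacent_intervals (a := fun k : ℕ => a - k)
          (fun k _ => hint _ _), ← intervalIntegral.integral_symm]
      simp
    _ ≤ ∫ t, ‖h' t‖ := by
      rw [intervalIntegral.integral_of_le (by simp)]
      exact setIntegral_le_integral hi.norm (Eventually.of_forall fun _ => norm_nonneg _)

/-- The Fourier coefficients of the dilates of a test function to scale `δ`, and the
variation of their sequence, are of size `O(δ)`. The first holds since the coefficients are the
values at the points `-δ t / (2π)` of `δ` times a Schwartz function `w`, the second since the
variation is then at most `δ` times the `L¹` norm of `w'`. -/
theorem exists_bound_fourier_dilate {β : ℝ → ℝ} (hβ : ContDiff ℝ ∞ β)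
    (hβc : HasCompactSupport β) :
    ∃ A : ℝ, 0 ≤ A ∧ ∀ δ : ℝ, 0 < δ →
      (∀ t : ℝ, ‖∫ θ : ℝ, (β (θ / δ) : ℂ) * Complex.exp ((t * θ : ℝ) * Complex.I)‖ ≤ A * δ) ∧
      ∀ (a : ℝ) (M : ℕ), ∑ k ∈ Finset.range M,
        ‖(∫ θ : ℝ, (β (θ / δ) : ℂ) * Complex.exp (((a - k) * θ : ℝ) * Complex.I)) -
          ∫ θ : ℝ, (β (θ / δ) : ℂ) * Complex.exp (((a - k - 1) * θ : ℝ) * Complex.I)‖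
          ≤ A * δ := by
  have hcs : HasCompactSupport (fun u => (β u : ℂ)) := hβc.comp_left Complex.ofReal_zero
  let w : SchwartzMap ℝ ℂ := 𝓕 (hcs.toSchwartzMap (Complex.ofRealCLM.contDiff.comp hβ))
  let w' : SchwartzMap ℝ ℂ := SchwartzMap.derivCLM ℂ ℂ w
  have key : ∀ δ : ℝ, 0 < δ → ∀ t : ℝ,
      (∫ θ : ℝ, (β (θ / δ) : ℂ) * Complex.exp ((t * θ : ℝ) * Complex.I))
        = δ * w (-(δ / (2 * π)) * t) := by
    intro δ hδ t
    have h1 := Measure.integral_comp_div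
      (fun u => (β u : ℂ) * Complex.exp ((t * (δ * u) : ℝ) * Complex.I)) δ
    rw [abs_of_pos hδ, Complex.real_smul] at h1
    have h2 : w (-(δ / (2 * π)) * t)
        = ∫ u, (β u : ℂ) * Complex.exp ((t * (δ * u) : ℝ) * Complex.I) := by
      simp only [w, SchwartzMap.fourier_coe]
      rw [Real.fourier_real_eq_integral_exp_smul]
      refine integral_congr_ae (Eventually.of_forall fun u => ?_)
      simp only [smul_eq_mul]
      rw [mul_comm]
      congr 4
      field_simp
    rw [h2, ← h1]
    refine integral_congr_ae (Eventually.of_forall fun θ => ?_)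
    simp only
    rw [mul_div_cancel₀ _ hδ.ne']
  obtain ⟨D, hD⟩ : ∃ D, ∀ t, ‖w t‖ ≤ D := by
    obtain ⟨D, -, hD⟩ := w.decay 0 0
    exact ⟨D, fun t => by simpa using hD t⟩
  have hD0 : 0 ≤ D := (norm_nonneg _).trans (hD 0)
  have hI0 : 0 ≤ ∫ t, ‖w' t‖ := integral_nonneg fun _ => norm_nonneg _
  refine ⟨D + ∫ t, ‖w' t‖, by positivity, fun δ hδ => ⟨fun t => ?_, fun a M => ?_⟩⟩
  · rw [key δ hδ, norm_mul, Complex.norm_real, Real.norm_of_nonneg hδ.le, mul_comm]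
    gcongr
    linarith [hD (-(δ / (2 * π)) * t)]
  · simp only [key δ hδ]
    set κ : ℝ := -(δ / (2 * π)) with hκ
    have hκ0 : κ ≠ 0 := by rw [hκ]; exact neg_ne_zero.2 (by positivity)
    have hd : ∀ t, HasDerivAt (fun t : ℝ => (δ : ℂ) * w (κ * t))
        ((δ : ℂ) * (κ • w' (κ * t))) t := by
      intro t
      have h1 : HasDerivAt w (w' (κ * t)) (κ * t) := by
        simpa [w'] using (w.differentiableAt (x := κ * t)).hasDerivAt
      exact (h1.scomp t (by simpa using (hasDerivAt_id t).const_mul κ)).const_mul _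
    have hwi : Integrable fun t => w' (κ * t) := w'.integrable.comp_mul_left' hκ0
    refine (sum_norm_sub_le_integral_norm_deriv hd (by fun_prop)
      ((hwi.smul κ).const_mul _) a M).trans ?_
    have h3 : ∫ t, ‖(δ : ℂ) * (κ • w' (κ * t))‖ = δ * ∫ t, ‖w' t‖ := by
      have h4 := Measure.integral_comp_mul_left (fun t => ‖w' t‖) κ
      simp only [norm_mul, norm_smul, Complex.norm_real, Real.norm_of_nonneg hδ.le]
      rw [integral_const_mul, integral_const_mul, h4, smul_eq_mul, abs_inv, ← mul_assoc ‖κ‖,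
        Real.norm_eq_abs, mul_inv_cancel₀ (abs_ne_zero.2 hκ0), one_mul]
    rw [h3]
    nlinarith

/-! ### The generating function on circles of radius `r > 1` -/

variable {X : Type*} [NormedAddCommGroup X] [NormedSpace ℂ X]

theorem norm_inv_pow_smul_le {x : ℕ → X} {K : ℝ} (hK : ∀ n, ‖x n‖ ≤ K) {r : ℝ} (hr : 1 < r)
    (n : ℕ) (θ : ℝ) :
    ‖(((r : ℂ) * Complex.exp ((θ : ℂ) * Complex.I)) ^ (n + 1))⁻¹ • x n‖
      ≤ K * r⁻¹ * r⁻¹ ^ n := by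
  have hr0 : 0 < r := one_pos.trans hr
  rw [norm_smul, norm_inv, norm_pow, norm_mul, Complex.norm_exp_ofReal_mul_I, mul_one,
    Complex.norm_real, Real.norm_of_nonneg hr0.le, mul_comm, ← inv_pow, pow_succ', ← mul_assoc]
  gcongr
  exact hK n

theorem summable_geometric_bound (K : ℝ) {r : ℝ}
    (hr : 1 < r) :
    Summable fun n : ℕ => K * r⁻¹ * r⁻¹ ^ n :=
  (summable_geometric_of_lt_one (inv_nonneg.2 (one_pos.trans hr).le)
    (inv_lt_one_of_one_lt₀ hr)).mul_left _

theorem continuous_genFun [CompleteSpace X] {x : ℕ → X} {K : ℝ} (hK : ∀ n, ‖x n‖ ≤ K) {r : ℝ}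
    (hr : 1 < r) :
    Continuous fun θ : ℝ => genFun x ((r : ℂ) * Complex.exp ((θ : ℂ) * Complex.I)) := by
  have hr0 : (r : ℂ) ≠ 0 := by exact_mod_cast (one_pos.trans hr).ne'
  refine continuous_tsum (fun k => ?_) (summable_geometric_bound K hr)
    fun k θ => norm_inv_pow_smul_le hK hr k θ
  exact (Continuous.inv₀ (by fun_prop) fun θ =>
    pow_ne_zero _ (mul_ne_zero hr0 (Complex.exp_ne_zero _))).smul continuous_const

/-- Termwise integration of the generating function on a circle of radius `r > 1`. -/
theorem hasSum_integral_genFun [CompleteSpace X] {x : ℕ → X} {K : ℝ} (hK : ∀ n, ‖x n‖ ≤ K)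
    {r : ℝ} (hr : 1 < r) {ψ : ℝ → ℂ} (hψ : Continuous ψ) (a b : ℝ) :
    HasSum (fun n : ℕ => (((r : ℂ) ^ (n + 1))⁻¹ *
        ∫ θ in a..b, ψ θ * Complex.exp ((-(n + 1) * θ : ℝ) * Complex.I)) • x n)
      (∫ θ in a..b, ψ θ • genFun x ((r : ℂ) * Complex.exp ((θ : ℂ) * Complex.I))) := by
  have hpow : ∀ (n : ℕ) (θ : ℝ), (((r : ℂ) * Complex.exp ((θ : ℂ) * Complex.I)) ^ (n + 1))⁻¹
      = ((r : ℂ) ^ (n + 1))⁻¹ * Complex.exp ((-(n + 1) * θ : ℝ) * Complex.I) := by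
    intro n θ
    rw [mul_pow, mul_inv, ← Complex.exp_nat_mul, ← Complex.exp_neg]
    push_cast
    ring_nf
  have hnorm := fun (n : ℕ) (θ : ℝ) => norm_inv_pow_smul_le hK hr n θ
  have hgeom : Summable fun n : ℕ => K * r⁻¹ * r⁻¹ ^ n := summable_geometric_bound K hr
  have h := intervalIntegral.hasSum_integral_of_dominated_convergence (μ := volume) (a := a)
    (b := b) (F := fun n θ => ψ θ •
      (((r : ℂ) * Complex.exp ((θ : ℂ) * Complex.I)) ^ (n + 1))⁻¹ • x n)
    (f := fun θ => ψ θ • genFun x ((r : ℂ) * Complex.exp ((θ : ℂ) * Complex.I)))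
    (fun n θ => ‖ψ θ‖ * (K * r⁻¹ * r⁻¹ ^ n)) ?_ ?_ ?_ ?_ ?_
  · convert h using 2 with n
    simp only [hpow, smul_smul]
    rw [intervalIntegral.integral_smul_const, ← intervalIntegral.integral_const_mul]
    congr 2
    ext θ
    ring
  · intro n
    simp only [hpow]
    exact Continuous.aestronglyMeasurable (by fun_prop)
  · refine fun n => Eventually.of_forall fun θ _ => ?_
    rw [norm_smul]
    gcongr
    exact hnorm n θ
  · exact Eventually.of_forall fun θ _ => hgeom.mul_left _
  · simp only [tsum_mul_left]
    exact Continuous.intervalIntegrable (by fun_prop) _ _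
  · refine Eventually.of_forall fun θ _ => ?_
    exact (Summable.of_norm_bounded hgeom fun n => hnorm n θ).hasSum.const_smul _

/-- Summation by parts, against coefficients of the form `r ^ (-(n + 1)) * p n`. -/
theorem norm_sum_smul_le {x : ℕ → X} {K : ℝ}
    (hK : ∀ n, ‖∑ k ∈ Finset.range (n + 1), x k‖ ≤ K) {r : ℝ} (hr : 1 < r) {p : ℕ → ℂ} {A : ℝ}
    (hp : ∀ n, ‖p n‖ ≤ A) (hpv : ∀ M, ∑ n ∈ Finset.range M, ‖p n - p (n + 1)‖ ≤ A) (M : ℕ) :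
    ‖∑ n ∈ Finset.range M, (((r : ℂ) ^ (n + 1))⁻¹ * p n) • x n‖ ≤ 3 * (K * A) := by
  have hr0 : 0 < r := one_pos.trans hr
  have hK0 : 0 ≤ K := (norm_nonneg _).trans (hK 0)
  have hA0 : 0 ≤ A := (norm_nonneg _).trans (hp 0)
  have hinv : r⁻¹ ≤ 1 := inv_le_one_of_one_le₀ hr.le
  have hrn : ∀ n : ℕ, ‖((r : ℂ) ^ n)⁻¹‖ = r⁻¹ ^ n := by
    intro n
    rw [norm_inv, norm_pow, Complex.norm_real, Real.norm_of_nonneg hr0.le, inv_pow]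
  rcases M with _ | M
  · simpa using by positivity
  rw [Finset.sum_range_by_parts]
  refine (norm_sub_le _ _).trans ?_
  have h1 : ‖(((r : ℂ) ^ (M + 1 - 1 + 1))⁻¹ * p (M + 1 - 1)) •
      ∑ k ∈ Finset.range (M + 1), x k‖ ≤ A * K := by
    rw [norm_smul, norm_mul, hrn]
    gcongr
    · calc r⁻¹ ^ (M + 1 - 1 + 1) * ‖p (M + 1 - 1)‖ ≤ 1 * A := by
            gcongr
            · exact pow_le_one₀ (by positivity) hinv
            · exact hp _
        _ = A := one_mul A
    · exact hK M
  have h2 : ∀ n, ‖((r : ℂ) ^ (n + 1 + 1))⁻¹ * p (n + 1) - ((r : ℂ) ^ (n + 1))⁻¹ * p n‖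
      ≤ ‖p n - p (n + 1)‖ + (r⁻¹ ^ (n + 1) - r⁻¹ ^ (n + 1 + 1)) * A := by
    intro n
    have hle : r⁻¹ ^ (n + 1 + 1) ≤ r⁻¹ ^ (n + 1) :=
      pow_le_pow_of_le_one (by positivity) hinv (Nat.le_succ _)
    have e : ((r : ℂ) ^ (n + 1 + 1))⁻¹ * p (n + 1) - ((r : ℂ) ^ (n + 1))⁻¹ * p n
        = -(((r : ℂ) ^ (n + 1))⁻¹ * (p n - p (n + 1)))
          - ((r⁻¹ ^ (n + 1) - r⁻¹ ^ (n + 1 + 1) : ℝ) : ℂ) * p (n + 1) := by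
      push_cast
      rw [inv_pow, inv_pow]
      ring
    rw [e]
    refine (norm_sub_le _ _).trans ?_
    rw [norm_neg, norm_mul, norm_mul, hrn, Complex.norm_real,
      Real.norm_of_nonneg (sub_nonneg.2 hle)]
    have h3 : r⁻¹ ^ (n + 1) ≤ 1 := pow_le_one₀ (by positivity) hinv
    have h4 := hp (n + 1)
    have h5 := sub_nonneg.2 hle
    gcongr
    exact mul_le_of_le_one_left (norm_nonneg _) h3
  have h3 : ‖∑ i ∈ Finset.range (M + 1 - 1),
      (((r : ℂ) ^ (i + 1 + 1))⁻¹ * p (i + 1) - ((r : ℂ) ^ (i + 1))⁻¹ * p i) •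
        ∑ k ∈ Finset.range (i + 1), x k‖ ≤ (A + A) * K := by
    refine (norm_sum_le _ _).trans ?_
    calc _ ≤ ∑ n ∈ Finset.range (M + 1 - 1),
          (‖p n - p (n + 1)‖ + (r⁻¹ ^ (n + 1) - r⁻¹ ^ (n + 1 + 1)) * A) * K := by
          refine Finset.sum_le_sum fun n _ => ?_
          rw [norm_smul]
          exact mul_le_mul (h2 n) (hK n) (norm_nonneg _) ((norm_nonneg _).trans (h2 n))
      _ ≤ (A + A) * K := by
          rw [← Finset.sum_mul, Finset.sum_add_distrib, ← Finset.sum_mul,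
            Finset.sum_range_sub' (fun n => r⁻¹ ^ (n + 1))]
          gcongr
          · exact hpv _
          · refine mul_le_of_le_one_left hA0 ?_
            have : 0 ≤ r⁻¹ ^ (M + 1 - 1 + 1) := by positivity
            simp only [zero_add, pow_one]
            linarith
  linarith

theorem integral_exp_int_mul_I (k : ℤ) :
    ∫ θ in -π..π, Complex.exp ((k * θ : ℝ) * Complex.I) = if k = 0 then (2 * π : ℂ) else 0 := by
  split_ifs with hk
  · subst hk
    simp
    ring
  · have hc : (k : ℂ) * Complex.I ≠ 0 :=
      mul_ne_zero (Int.cast_ne_zero.2 hk) Complex.I_ne_zero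
    have h := integral_exp_mul_complex (a := -π) (b := π) hc
    have e : Complex.exp (k * Complex.I * π) = Complex.exp (k * Complex.I * (-π : ℝ)) := by
      rw [Complex.exp_eq_exp_iff_exists_int]
      exact ⟨k, by push_cast; ring⟩
    rw [e, sub_self, zero_div] at h
    rw [← h]
    congr 1
    ext θ
    push_cast
    ring_nf

theorem integral_exp_smul_genFun [CompleteSpace X] {x : ℕ → X} {K : ℝ} (hK : ∀ n, ‖x n‖ ≤ K)
    {r : ℝ} (hr : 1 < r) (n : ℕ) :
    ∫ θ in -π..π, Complex.exp (((n + 1) * θ : ℝ) * Complex.I) •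
        genFun x ((r : ℂ) * Complex.exp ((θ : ℂ) * Complex.I))
      = (((r : ℂ) ^ (n + 1))⁻¹ * (2 * π)) • x n := by
  have h := hasSum_integral_genFun hK hr
    (ψ := fun θ : ℝ => Complex.exp (((n + 1) * θ : ℝ) * Complex.I)) (by fun_prop) (-π) π
  have hcoef : ∀ k : ℕ, ∫ θ in -π..π, Complex.exp (((n + 1) * θ : ℝ) * Complex.I) *
      Complex.exp ((-(k + 1) * θ : ℝ) * Complex.I) = if k = n then (2 * π : ℂ) else 0 := by
    intro k
    have e := integral_exp_int_mul_I ((n : ℤ) - k)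
    simp only [sub_eq_zero, Nat.cast_inj] at e
    rw [if_congr (eq_comm (a := k)) rfl rfl, ← e]
    congr 1
    ext θ
    rw [← Complex.exp_add]
    push_cast
    ring_nf
  simp only [hcoef] at h
  refine h.unique ?_
  convert hasSum_single n fun k hk => ?_ using 1
  · simp
  · simp [hk]

/-- The low-frequency part is `O(δ)`, with a constant that depends only on the test function and on
the bound for the partial sums. -/
theorem norm_integral_dilate_smul_genFun_le [CompleteSpace X] {β : ℝ → ℝ}
    (hβ : ContDiff ℝ ∞ β) (hβc : HasCompactSupport β) (hβ2 : ∀ u, 2 ≤ |u| → β u = 0) :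
    ∃ A : ℝ, 0 ≤ A ∧ ∀ {x : ℕ → X} {K₁ K : ℝ}, (∀ n, ‖x n‖ ≤ K₁) →
      (∀ n, ‖∑ k ∈ Finset.range (n + 1), x k‖ ≤ K) → ∀ δ : ℝ, 0 < δ → 2 * δ ≤ π →
      ∀ (n : ℕ) (r : ℝ), 1 < r →
      ‖∫ θ in -π..π, ((β (θ / δ) : ℂ) * Complex.exp (((n + 1) * θ : ℝ) * Complex.I)) •
        genFun x ((r : ℂ) * Complex.exp ((θ : ℂ) * Complex.I))‖ ≤ 3 * (K * (A * δ)) := by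
  obtain ⟨A, hA0, hA⟩ := exists_bound_fourier_dilate hβ hβc
  refine ⟨A, hA0, fun {x K₁ K} hK₁ hK δ hδ hδπ n r hr => ?_⟩
  obtain ⟨hA1, hA2⟩ := hA δ hδ
  have hβcont := hβ.continuous
  have hcoef : ∀ k : ℕ, ∫ θ in -π..π, ((β (θ / δ) : ℂ) *
      Complex.exp (((n + 1) * θ : ℝ) * Complex.I)) * Complex.exp ((-(k + 1) * θ : ℝ) * Complex.I)
      = ∫ θ : ℝ, (β (θ / δ) : ℂ) * Complex.exp (((n - k) * θ : ℝ) * Complex.I) := by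
    intro k
    rw [← intervalIntegral.integral_eq_integral_of_support_subset (a := -π) (b := π)]
    · congr 1
      ext θ
      rw [mul_assoc, ← Complex.exp_add]
      push_cast
      ring_nf
    · intro θ hθ
      have h1 : |θ / δ| < 2 := by
        by_contra hcon
        exact hθ (by simp [hβ2 _ (not_lt.1 hcon)])
      rw [abs_div, abs_of_pos hδ, div_lt_iff₀ hδ] at h1
      have h2 := abs_lt.1 (h1.trans_le hδπ)
      exact ⟨h2.1, h2.2.le⟩
  have h := hasSum_integral_genFun hK₁ hr
    (ψ := fun θ : ℝ => (β (θ / δ) : ℂ) * Complex.exp (((n + 1) * θ : ℝ) * Complex.I))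
    (by fun_prop) (-π) π
  simp only [hcoef] at h
  refine le_of_tendsto h.tendsto_sum_nat.norm (Eventually.of_forall fun M => ?_)
  refine norm_sum_smul_le hK hr (fun k => hA1 _) (fun M => ?_) M
  simpa only [Nat.cast_succ, sub_sub] using hA2 n M

/-- The coefficient `2π x_n` is the integral of `F` against `e ^ (i (n + 1) θ)`, cut off to
`|θ| ≥ δ`, up to an error `O(δ)` that is uniform in `n`. -/
theorem exists_norm_sub_integral_le [CompleteSpace X] {β : ℝ → ℝ}
    (hβ : ContDiff ℝ ∞ β) (hβc : HasCompactSupport β) (hβ1 : ∀ u, |u| ≤ 1 → β u = 1)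
    (hβ2 : ∀ u, 2 ≤ |u| → β u = 0) {x : ℕ → X} {K₁ K : ℝ} (hK₁ : ∀ n, ‖x n‖ ≤ K₁)
    (hK : ∀ n, ‖∑ k ∈ Finset.range (n + 1), x k‖ ≤ K) {F : Circle → X}
    (hF : IsBoundaryFunction (genFun x) F) :
    ∃ A : ℝ, 0 ≤ A ∧ ∀ δ : ℝ, 0 < δ → 2 * δ ≤ π → ∀ n : ℕ,
      ‖(2 * π : ℂ) • x n - ∫ θ in -π..π, (((1 - β (θ / δ) : ℝ) : ℂ) *
        Complex.exp (((n + 1) * θ : ℝ) * Complex.I)) • F (Circle.exp θ)‖ ≤ A * δ := by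
  have hK0 : 0 ≤ K := (norm_nonneg _).trans (hK 0)
  obtain ⟨A, hA0, hA⟩ := norm_integral_dilate_smul_genFun_le (X := X) hβ hβc hβ2
  refine ⟨3 * (K * A), by positivity, fun δ hδ hδπ n => ?_⟩
  have hβcont := hβ.continuous
  have hlim := hF.2 (fun θ => ((1 - β (θ / δ) : ℝ) : ℂ) *
    Complex.exp (((n + 1) * θ : ℝ) * Complex.I)) (by fun_prop) (by
      have hsub : {θ : ℝ | θ ∈ Icc (-π) π ∧ ((1 - β (θ / δ) : ℝ) : ℂ) *
          Complex.exp (((n + 1) * θ : ℝ) * Complex.I) ≠ 0} ⊆ {θ : ℝ | δ ≤ |θ|} := by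
        rintro θ ⟨-, hθ⟩
        by_contra hcon
        refine hθ ?_
        rw [hβ1 (θ / δ) (by
          rw [abs_div, abs_of_pos hδ, div_le_one hδ]
          exact (not_le.1 hcon).le)]
        simp
      intro h0
      have := closure_minimal hsub (isClosed_le continuous_const continuous_abs) h0
      simp only [mem_ofPred_eq, abs_zero] at this
      linarith)
  have hpow : Tendsto (fun r : ℝ => (((r : ℂ) ^ (n + 1))⁻¹ * (2 * π : ℂ)) • x n) (𝓝[>] 1)
      (𝓝 ((2 * π : ℂ) • x n)) := by
    have hc : ContinuousAt (fun r : ℝ => (((r : ℂ) ^ (n + 1))⁻¹ * (2 * π : ℂ)) • x n) 1 := by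
      refine ContinuousAt.smul (ContinuousAt.mul (ContinuousAt.inv₀ ?_ ?_) continuousAt_const)
        continuousAt_const
      · fun_prop
      · simp
    have := hc.tendsto.mono_left (nhdsWithin_le_nhds (s := Ioi 1))
    simpa using this
  refine le_of_tendsto (hpow.sub hlim).norm ?_
  filter_upwards [self_mem_nhdsWithin] with r hr
  have hr1 : 1 < r := hr
  have hcont := continuous_genFun hK₁ hr1
  rw [← integral_exp_smul_genFun hK₁ hr1, ← intervalIntegral.integral_sub]
  · have h := hA hK₁ hK δ hδ hδπ n r hr1
    refine le_trans (le_of_eq ?_) (h.trans_eq (by ring))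
    congr 2
    ext θ
    rw [← sub_smul]
    congr 1
    push_cast
    ring
  · exact Continuous.intervalIntegrable (by fun_prop) _ _
  · exact Continuous.intervalIntegrable (by fun_prop) _ _

/-! ### Derivatives along the circle and integration by parts -/

theorem circleExp_ne_one {θ : ℝ} (h0 : 0 < |θ|) (hπ : |θ| ≤ π) : Circle.exp θ ≠ 1 := by
  rw [Ne, Circle.exp_eq_one]
  rintro ⟨k, rfl⟩
  rw [abs_mul, abs_of_pos Real.two_pi_pos, ← Int.cast_abs] at h0 hπ
  have hk : |k| < 1 := by
    by_contra hcon
    have : (1 : ℝ) ≤ (|k| : ℤ) := by exact_mod_cast not_lt.1 hcon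
    nlinarith [Real.pi_pos]
  rw [Int.abs_lt_one_iff] at hk
  simp [hk] at h0

theorem isOpen_circleExp_ne_one : IsOpen {θ : ℝ | Circle.exp θ ≠ 1} :=
  isOpen_ne.preimage Circle.exp.continuous

theorem circleDeriv_exp (F : Circle → X) (θ : ℝ) :
    circleDeriv F (Circle.exp θ)
      = (Complex.I * (Circle.exp θ : ℂ))⁻¹ • deriv (fun t : ℝ => F (Circle.exp t)) θ := by
  have h := deriv_comp_const_add (fun t : ℝ => F (Circle.exp t)) θ 0
  simp only [Circle.exp_add, add_zero] at h
  rw [circleDeriv, h]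

theorem contDiffOn_iteratedCircleDeriv {F : Circle → X}
    (hF : ContMDiffOn (𝓡 1) 𝓘(ℝ, X) ((⊤ : ℕ∞) : WithTop ℕ∞) F {z : Circle | z ≠ 1}) (j : ℕ) :
    ContDiffOn ℝ ∞ (fun θ : ℝ => iteratedCircleDeriv j F (Circle.exp θ))
      {θ : ℝ | Circle.exp θ ≠ 1} := by
  induction j with
  | zero =>
    rw [← contMDiffOn_iff_contDiffOn]
    exact hF.comp contMDiff_circleExp.contMDiffOn fun θ hθ => hθ
  | succ j ih =>
    simp only [iteratedCircleDeriv, Function.iterate_succ_apply', circleDeriv_exp]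
    have h1 : ContDiff ℝ ∞ fun θ : ℝ => (Complex.I * (Circle.exp θ : ℂ))⁻¹ := by
      simp only [Circle.coe_exp]
      refine ContDiff.inv ?_ fun θ => mul_ne_zero Complex.I_ne_zero (Complex.exp_ne_zero _)
      exact contDiff_const.mul ((Complex.ofRealCLM.contDiff.mul contDiff_const).cexp)
    exact h1.contDiffOn.smul (ih.deriv_of_isOpen isOpen_circleExp_ne_one (by simp))

theorem hasDerivAt_iteratedCircleDeriv {F : Circle → X}
    (hF : ContMDiffOn (𝓡 1) 𝓘(ℝ, X) ((⊤ : ℕ∞) : WithTop ℕ∞) F {z : Circle | z ≠ 1}) (j : ℕ)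
    {θ : ℝ} (hθ : Circle.exp θ ≠ 1) :
    HasDerivAt (fun θ : ℝ => iteratedCircleDeriv j F (Circle.exp θ))
      ((Complex.I * (Circle.exp θ : ℂ)) • iteratedCircleDeriv (j + 1) F (Circle.exp θ)) θ := by
  have h := (((contDiffOn_iteratedCircleDeriv hF j).differentiableOn (by simp)).differentiableAt
    (isOpen_circleExp_ne_one.mem_nhds hθ)).hasDerivAt
  convert h using 1
  rw [iteratedCircleDeriv, Function.iterate_succ_apply', circleDeriv_exp, smul_inv_smul₀]
  · rfl
  · exact mul_ne_zero Complex.I_ne_zero (Circle.coe_ne_zero _)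

theorem hasDerivAt_circleExp_pow (k : ℕ) (θ : ℝ) :
    HasDerivAt (fun θ : ℝ => (Circle.exp θ : ℂ) ^ k)
      (k * Complex.I * (Circle.exp θ : ℂ) ^ k) θ := by
  have h1 : HasDerivAt (fun θ : ℝ => (θ : ℂ) * Complex.I) Complex.I θ := by
    simpa using (Complex.ofRealCLM.hasDerivAt (x := θ)).mul_const Complex.I
  have h := h1.cexp.pow k
  simp only [Circle.coe_exp]
  refine h.congr_deriv ?_
  rcases k with _ | k
  · simp
  · simp only [Nat.add_sub_cancel, pow_succ]
    ring

/-- A function vanishing near `0` makes up for the lack of regularity of `f` at `0`. -/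
theorem continuousOn_smul_of_vanish {ρ : ℝ → ℂ} (hρ : Continuous ρ) {δ : ℝ} (hδ : 0 < δ)
    (hρ0 : ∀ θ, |θ| < δ → ρ θ = 0) {f : ℝ → X}
    (hf : ∀ θ, 0 < |θ| → |θ| ≤ π → ContinuousAt f θ) :
    ContinuousOn (fun θ => ρ θ • f θ) (uIcc (-π) π) := by
  intro θ hθ
  rw [uIcc_of_le (by linarith [Real.pi_pos])] at hθ
  refine ContinuousAt.continuousWithinAt ?_
  rcases lt_or_ge |θ| δ with h | h
  · have : (fun θ => ρ θ • f θ) =ᶠ[𝓝 θ] fun _ => 0 := by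
      filter_upwards [(isOpen_lt continuous_abs continuous_const).mem_nhds h] with t ht
      rw [hρ0 t ht, zero_smul]
    exact continuousAt_const.congr this.symm
  · exact hρ.continuousAt.smul (hf θ (hδ.trans_le h) (abs_le.2 hθ))

theorem deriv_eq_zero_of_vanish {χ : ℝ → ℝ} {δ : ℝ} (hχ0 : ∀ θ, |θ| < δ → χ θ = 0) {θ : ℝ}
    (h : |θ| < δ) : deriv χ θ = 0 := by
  have : χ =ᶠ[𝓝 θ] fun _ => 0 := by
    filter_upwards [(isOpen_lt continuous_abs continuous_const).mem_nhds h] with t ht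
    exact hχ0 t ht
  rw [this.deriv_eq, deriv_const]

/-- Integration by parts on the circle, with respect to the circle variable, of a function that is
cut off near `1`. -/
theorem integral_cutoff_by_parts [CompleteSpace X] {χ : ℝ → ℝ} (hχ : ContDiff ℝ ∞ χ) {δ : ℝ}
    (hδ : 0 < δ) (hχ0 : ∀ θ, |θ| < δ → χ θ = 0) (hχπ : χ (-π) = χ π) {f g : Circle → X}
    (hf : ∀ θ : ℝ, 0 < |θ| → |θ| ≤ π → HasDerivAt (fun θ : ℝ => f (Circle.exp θ))
      ((Complex.I * (Circle.exp θ : ℂ)) • g (Circle.exp θ)) θ)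
    (hg : ∀ θ : ℝ, 0 < |θ| → |θ| ≤ π → ContinuousAt (fun θ : ℝ => g (Circle.exp θ)) θ)
    (k : ℕ) :
    (∫ θ in -π..π, (((deriv χ θ : ℝ) : ℂ) * (Circle.exp θ : ℂ) ^ k) • f (Circle.exp θ))
      + (k * Complex.I) • (∫ θ in -π..π, ((χ θ : ℂ) * (Circle.exp θ : ℂ) ^ k) • f (Circle.exp θ))
      + Complex.I • ∫ θ in -π..π,
          ((χ θ : ℂ) * (Circle.exp θ : ℂ) ^ (k + 1)) • g (Circle.exp θ) = 0 := by
  have hχc : Continuous χ := hχ.continuous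
  have hχc' : Continuous (deriv χ) := hχ.continuous_deriv (by simp)
  have hd0 : ∀ θ, |θ| < δ → deriv χ θ = 0 := fun θ h => deriv_eq_zero_of_vanish hχ0 h
  have hfc := fun θ h0 hπ => (hf θ h0 hπ).continuousAt
  have i1 : IntervalIntegrable (fun θ : ℝ => (((deriv χ θ : ℝ) : ℂ) * (Circle.exp θ : ℂ) ^ k) •
      f (Circle.exp θ)) volume (-π) π :=
    (continuousOn_smul_of_vanish (by fun_prop) hδ (fun θ h => by simp [hd0 θ h])
      hfc).intervalIntegrable
  have i2 : IntervalIntegrable (fun θ : ℝ => ((χ θ : ℂ) * (Circle.exp θ : ℂ) ^ k) •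
      f (Circle.exp θ)) volume (-π) π :=
    (continuousOn_smul_of_vanish (by fun_prop) hδ (fun θ h => by simp [hχ0 θ h])
      hfc).intervalIntegrable
  have i3 : IntervalIntegrable (fun θ : ℝ => ((χ θ : ℂ) * (Circle.exp θ : ℂ) ^ (k + 1)) •
      g (Circle.exp θ)) volume (-π) π :=
    (continuousOn_smul_of_vanish (by fun_prop) hδ (fun θ h => by simp [hχ0 θ h])
      hg).intervalIntegrable
  have i2' : IntervalIntegrable (fun θ : ℝ => (k * Complex.I) •
      (((χ θ : ℂ) * (Circle.exp θ : ℂ) ^ k) • f (Circle.exp θ))) volume (-π) π :=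
    i2.smul (k * Complex.I)
  have i3' : IntervalIntegrable (fun θ : ℝ => Complex.I •
      (((χ θ : ℂ) * (Circle.exp θ : ℂ) ^ (k + 1)) • g (Circle.exp θ))) volume (-π) π :=
    i3.smul Complex.I
  have hderiv : ∀ θ ∈ uIcc (-π) π, HasDerivAt
      (fun θ : ℝ => ((χ θ : ℂ) * (Circle.exp θ : ℂ) ^ k) • f (Circle.exp θ))
      ((((deriv χ θ : ℝ) : ℂ) * (Circle.exp θ : ℂ) ^ k) • f (Circle.exp θ)
        + (k * Complex.I) • (((χ θ : ℂ) * (Circle.exp θ : ℂ) ^ k) • f (Circle.exp θ))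
        + Complex.I • (((χ θ : ℂ) * (Circle.exp θ : ℂ) ^ (k + 1)) • g (Circle.exp θ))) θ := by
    intro θ hθ
    rw [uIcc_of_le (by linarith [Real.pi_pos])] at hθ
    rcases lt_or_ge |θ| δ with h | h
    · have : (fun θ : ℝ => ((χ θ : ℂ) * (Circle.exp θ : ℂ) ^ k) • f (Circle.exp θ))
          =ᶠ[𝓝 θ] fun _ => 0 := by
        filter_upwards [(isOpen_lt continuous_abs continuous_const).mem_nhds h] with t ht
        simp [hχ0 t ht]
      simpa [hχ0 θ h, hd0 θ h] using (hasDerivAt_const θ (0 : X)).congr_of_eventuallyEq this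
    · have h1 : HasDerivAt (fun θ => (χ θ : ℂ)) ((deriv χ θ : ℝ) : ℂ) θ :=
        ((hχ.differentiable (by simp)) θ).hasDerivAt.ofReal_comp
      have h2 := (h1.mul (hasDerivAt_circleExp_pow k θ)).smul
        (hf θ (hδ.trans_le h) (abs_le.2 hθ))
      refine h2.congr_deriv ?_
      simp only [Pi.mul_apply]
      module
  have hint := intervalIntegral.integral_eq_sub_of_hasDerivAt hderiv ((i1.add i2').add i3')
  have hper : Circle.exp (-π) = Circle.exp π := by
    rw [Circle.exp_eq_exp]
    exact ⟨-1, by push_cast; ring⟩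
  rw [hper, hχπ, sub_self, intervalIntegral.integral_add (i1.add i2') i3',
    intervalIntegral.integral_add i1 i2', intervalIntegral.integral_smul,
    intervalIntegral.integral_smul] at hint
  exact hint

/-- Iteration of the bound that one integration by parts gives. -/
theorem le_sum_of_le_add_div {T d : ℕ → ℝ} {N : ℝ} (hN : 0 < N)
    (h : ∀ j, T j ≤ (d j + T (j + 1)) / N) (J : ℕ) :
    T 0 ≤ ∑ j ∈ Finset.range J, d j / N ^ (j + 1) + T J / N ^ J := by
  induction J with
  | zero => simp
  | succ J ih =>
    refine ih.trans ?_
    rw [Finset.sum_range_succ, add_assoc]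
    gcongr
    calc T J / N ^ J ≤ ((d J + T (J + 1)) / N) / N ^ J := by gcongr; exact h J
      _ = _ := by rw [div_div, ← pow_succ', add_div]

/-- The estimate of the high-frequency part by `J` integrations by parts. Each step uses the
derivative of the cutoff only once, and on `δ ≤ |θ| ≤ 2δ`, where the factor `|θ|` of the hypothesis
on `F` yields the factor `δ` of the sum. -/
theorem norm_integral_cutoff_le [CompleteSpace X] {χ : ℝ → ℝ} (hχ : ContDiff ℝ ∞ χ)
    {δ B : ℝ} (hδ : 0 < δ) (hδπ : 2 * δ ≤ π) (hB : 0 ≤ B) (hχ0 : ∀ θ, |θ| < δ → χ θ = 0)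
    (hχ1 : ∀ θ, |χ θ| ≤ 1) (hχπ : χ (-π) = χ π) (hχ' : ∀ θ, |deriv χ θ| ≤ B / δ)
    (hχ'0 : ∀ θ, 2 * δ ≤ |θ| → deriv χ θ = 0) {F : Circle → X}
    (hF : ContMDiffOn (𝓡 1) 𝓘(ℝ, X) ((⊤ : ℕ∞) : WithTop ℕ∞) F {z : Circle | z ≠ 1})
    {C μ : ℝ} (hC : 0 ≤ C) (hμ : 0 ≤ μ)
    (hbound : ∀ (j : ℕ) (θ : ℝ), δ ≤ |θ| → |θ| ≤ π →
      ‖iteratedCircleDeriv j F (Circle.exp θ)‖ ≤ C * (j.factorial : ℝ) * |θ| * μ ^ (j + 1))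
    {N : ℕ} (hN : 0 < N) (J : ℕ) :
    ‖∫ θ in -π..π, ((χ θ : ℂ) * (Circle.exp θ : ℂ) ^ N) • F (Circle.exp θ)‖ ≤
      8 * B * C * δ * ∑ j ∈ Finset.range J, (j.factorial : ℝ) * (μ / N) ^ (j + 1)
        + 2 * π ^ 2 * C * (μ * (J.factorial * (μ / N) ^ J)) := by
  set T : ℕ → X := fun j => ∫ θ in -π..π, ((χ θ : ℂ) * (Circle.exp θ : ℂ) ^ (N + j)) •
    iteratedCircleDeriv j F (Circle.exp θ) with hT
  have hN' : (0 : ℝ) < N := by exact_mod_cast hN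
  have hπ := Real.pi_pos
  have hrec : ∀ j, ‖T j‖ ≤ (8 * B * C * δ * j.factorial * μ ^ (j + 1) + ‖T (j + 1)‖) / N := by
    intro j
    have hd := fun (i : ℕ) (θ : ℝ) (h0 : 0 < |θ|) (h1 : |θ| ≤ π) =>
      hasDerivAt_iteratedCircleDeriv hF i (circleExp_ne_one h0 h1)
    have h := integral_cutoff_by_parts hχ hδ hχ0 hχπ (hd j)
      (fun θ h0 h1 => (hd (j + 1) θ h0 h1).continuousAt) (N + j)
    set D : X := ∫ θ in -π..π, (((deriv χ θ : ℝ) : ℂ) * (Circle.exp θ : ℂ) ^ (N + j)) •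
      iteratedCircleDeriv j F (Circle.exp θ) with hD
    have hDle : ‖D‖ ≤ 8 * B * C * δ * j.factorial * μ ^ (j + 1) := by
      have hsupp : Function.support (fun θ : ℝ => (((deriv χ θ : ℝ) : ℂ) *
          (Circle.exp θ : ℂ) ^ (N + j)) • iteratedCircleDeriv j F (Circle.exp θ))
          ⊆ Ioc (-(2 * δ)) (2 * δ) := by
        intro θ hθ
        have h1 : |θ| < 2 * δ := by
          by_contra hcon
          exact hθ (by simp [hχ'0 θ (not_lt.1 hcon)])
        exact ⟨(abs_lt.1 h1).1, (abs_lt.1 h1).2.le⟩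
      have hsupp' := hsupp.trans (Ioc_subset_Ioc (neg_le_neg hδπ) hδπ)
      rw [hD, intervalIntegral.integral_eq_integral_of_support_subset hsupp',
        ← intervalIntegral.integral_eq_integral_of_support_subset hsupp]
      refine (intervalIntegral.norm_integral_le_of_norm_le_const
        (C := B / δ * (C * j.factorial * (2 * δ) * μ ^ (j + 1))) fun θ hθ => ?_).trans_eq ?_
      · rw [uIoc_of_le (by linarith)] at hθ
        have hθ' : |θ| ≤ 2 * δ := abs_le.2 ⟨hθ.1.le, hθ.2⟩
        rw [norm_smul, norm_mul, norm_pow, Circle.norm_coe, one_pow, mul_one,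
          Complex.norm_real, Real.norm_eq_abs]
        rcases lt_or_ge |θ| δ with h1 | h1
        · rw [deriv_eq_zero_of_vanish hχ0 h1, abs_zero, zero_mul]
          positivity
        · refine mul_le_mul (hχ' θ) ((hbound j θ h1 (hθ'.trans hδπ)).trans ?_) (norm_nonneg _)
            (by positivity)
          gcongr
      · rw [show 2 * δ - -(2 * δ) = 4 * δ by ring, abs_of_pos (by positivity)]
        field_simp
        ring
    have h1 : (((N + j : ℕ) : ℂ) * Complex.I) • T j = -(D + Complex.I • T (j + 1)) := by
      rw [eq_neg_iff_add_eq_zero, ← h]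
      simp only [hT, hD, ← add_assoc]
      abel
    have h2 : ((N + j : ℕ) : ℝ) * ‖T j‖ ≤ ‖D‖ + ‖T (j + 1)‖ := by
      have := congrArg norm h1
      rw [norm_smul, norm_mul, Complex.norm_I, mul_one, Complex.norm_natCast, norm_neg] at this
      rw [this]
      refine (norm_add_le _ _).trans_eq ?_
      rw [norm_smul, Complex.norm_I, one_mul]
    rw [le_div_iff₀ hN']
    have h3 : ‖T j‖ * N ≤ ((N + j : ℕ) : ℝ) * ‖T j‖ := by
      rw [mul_comm]
      gcongr
      omega
    linarith
  have hend : ‖T J‖ ≤ 2 * π ^ 2 * C * J.factorial * μ ^ (J + 1) := by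
    refine (intervalIntegral.norm_integral_le_of_norm_le_const
      (C := 1 * (C * J.factorial * π * μ ^ (J + 1))) fun θ hθ => ?_).trans_eq ?_
    · rw [uIoc_of_le (by linarith)] at hθ
      have hθ' : |θ| ≤ π := abs_le.2 ⟨hθ.1.le, hθ.2⟩
      rw [norm_smul, norm_mul, norm_pow, Circle.norm_coe, one_pow, mul_one,
        Complex.norm_real, Real.norm_eq_abs]
      rcases lt_or_ge |θ| δ with h1 | h1
      · rw [hχ0 θ h1, abs_zero, zero_mul]
        positivity
      · refine mul_le_mul (hχ1 θ) ((hbound J θ h1 hθ').trans ?_) (norm_nonneg _) zero_le_one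
        gcongr
    · rw [show π - -π = 2 * π by ring, abs_of_pos (by positivity)]
      ring
  have h := le_sum_of_le_add_div hN' hrec J
  refine h.trans ?_
  rw [Finset.mul_sum]
  gcongr with j hj
  · refine le_of_eq ?_
    rw [div_pow]
    ring
  · calc ‖T J‖ / (N : ℝ) ^ J ≤ 2 * π ^ 2 * C * J.factorial * μ ^ (J + 1) / (N : ℝ) ^ J := by gcongr
      _ = _ := by rw [div_pow]; ring

/-! ### Factorials and the size of the remainder -/

/-- A form of Stirling's upper bound, with a superfluous factor `√(J + 1)`. -/
theorem factorial_mul_exp_le (J : ℕ) :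
    ((J + 1).factorial : ℝ) * Real.exp J ≤ ((J : ℝ) + 1) ^ (J + 2) := by
  induction J with
  | zero => simp
  | succ J ih =>
    -- `((J + 1) / (J + 2)) ^ (J + 2) ≤ 1 / e`
    have h1 : Real.exp 1 * ((J : ℝ) + 1) ^ (J + 2) ≤ ((J : ℝ) + 2) ^ (J + 2) := by
      have h2 : ((J : ℝ) + 1) / (J + 2) ≤ Real.exp (-(1 / (J + 2))) := by
        refine le_trans (le_of_eq ?_) (Real.add_one_le_exp _)
        field_simp
        ring
      have h3 := pow_le_pow_left₀ (by positivity) h2 (J + 2)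
      rw [← Real.exp_nat_mul, div_pow, div_le_iff₀ (by positivity)] at h3
      have h4 : ((J + 2 : ℕ) : ℝ) * -(1 / ((J : ℝ) + 2)) = -1 := by
        push_cast
        field_simp
      rw [h4] at h3
      calc Real.exp 1 * ((J : ℝ) + 1) ^ (J + 2)
          ≤ Real.exp 1 * (Real.exp (-1) * ((J : ℝ) + 2) ^ (J + 2)) := by gcongr
        _ = _ := by rw [← mul_assoc, ← Real.exp_add]; simp
    rw [Nat.factorial_succ]
    push_cast
    rw [Real.exp_add]
    calc ((J : ℝ) + 1 + 1) * ((J + 1).factorial : ℝ) * (Real.exp J * Real.exp 1)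
        = (J + 2) * (Real.exp 1 * (((J + 1).factorial : ℝ) * Real.exp J)) := by ring
      _ ≤ (J + 2) * (Real.exp 1 * ((J : ℝ) + 1) ^ (J + 2)) := by gcongr
      _ ≤ (J + 2) * ((J : ℝ) + 2) ^ (J + 2) := by gcongr
      _ = _ := by ring

theorem factorial_mul_pow_le {J : ℕ} {q : ℝ} (hq : 0 ≤ q) (hJ : J * q ≤ 1) :
    (J.factorial : ℝ) * q ^ J ≤ Real.exp 1 * ((J + 1) * Real.exp (-J)) := by
  rcases J with _ | J
  · simp
  · have h := factorial_mul_exp_le J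
    have h2 : (((J + 1 : ℕ) : ℝ) * q) ^ (J + 1) ≤ 1 := pow_le_one₀ (by positivity) hJ
    have h3 : ((J + 1).factorial : ℝ) ≤ ((J : ℝ) + 1) ^ (J + 2) * Real.exp (-J) := by
      rw [Real.exp_neg, ← div_eq_mul_inv, le_div_iff₀ (Real.exp_pos _)]
      exact h
    calc ((J + 1).factorial : ℝ) * q ^ (J + 1)
        ≤ ((J : ℝ) + 1) ^ (J + 2) * Real.exp (-J) * q ^ (J + 1) := by gcongr
      _ = ((J : ℝ) + 1) * Real.exp (-J) * (((J + 1 : ℕ) : ℝ) * q) ^ (J + 1) := by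
        rw [mul_pow]; push_cast; ring
      _ ≤ ((J : ℝ) + 1) * Real.exp (-J) * 1 := by gcongr
      _ ≤ (((J + 1 : ℕ) : ℝ) + 1) * Real.exp (-J) := by
        rw [mul_one]; push_cast; gcongr; linarith
      _ = _ := by
        have : Real.exp (-J) = Real.exp 1 * Real.exp (-((J + 1 : ℕ) : ℝ)) := by
          rw [← Real.exp_add]; push_cast; ring_nf
        rw [this]; ring

theorem sum_factorial_mul_pow_le_one {J : ℕ} {q : ℝ} (hq : 0 ≤ q) (hJ : J * q ≤ 1) :
    ∑ j ∈ Finset.range J, (j.factorial : ℝ) * q ^ (j + 1) ≤ 1 := by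
  calc ∑ j ∈ Finset.range J, (j.factorial : ℝ) * q ^ (j + 1)
      ≤ ∑ _j ∈ Finset.range J, q := by
        refine Finset.sum_le_sum fun j hj => ?_
        have h1 : (j.factorial : ℝ) ≤ (J : ℝ) ^ j := by
          exact_mod_cast (Nat.factorial_le_pow j).trans
            (Nat.pow_le_pow_left (Finset.mem_range.1 hj).le j)
        calc (j.factorial : ℝ) * q ^ (j + 1) ≤ (J : ℝ) ^ j * q ^ (j + 1) := by gcongr
          _ = (J * q) ^ j * q := by ring
          _ ≤ 1 * q := by gcongr; exact pow_le_one₀ (by positivity) hJ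
          _ = q := one_mul q
    _ = J * q := by simp
    _ ≤ 1 := hJ

/-- The size of the remainder after `⌊n / μ⌋` integrations by parts, where `c n = μ log (1 + μ/δ)`.
The room between `c` and `1` absorbs the polynomial factor in Stirling's bound. -/
theorem remainder_le {μ δ c : ℝ} (hμ : 0 < μ) (hδ : 0 < δ) (hc0 : 0 < c) (hc1 : c < 1) {n : ℕ}
    (hn : μ * Real.log (1 + μ / δ) = c * n) {q : ℝ} (hq : 0 ≤ q) (hJ : ⌊n / μ⌋₊ * q ≤ 1) :
    μ * ((⌊n / μ⌋₊.factorial : ℝ) * q ^ ⌊n / μ⌋₊) ≤ Real.exp 1 ^ 2 / (1 - c) * δ := by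
  set y : ℝ := n / μ with hy
  have hy0 : 0 ≤ y := by positivity
  have hc : 0 < 1 - c := by linarith
  have hlog : Real.log (1 + μ / δ) = c * y := by
    rw [hy, ← mul_div_assoc, eq_div_iff hμ.ne', ← hn, mul_comm]
  have h1 : (⌊y⌋₊ : ℝ) ≤ y := Nat.floor_le hy0
  have h2 : y ≤ ⌊y⌋₊ + 1 := (Nat.lt_floor_add_one y).le
  have h3 : Real.exp (-⌊y⌋₊) ≤ Real.exp 1 * Real.exp (-y) := by
    rw [← Real.exp_add]; exact Real.exp_le_exp.2 (by linarith)
  have h4 : μ * Real.exp (-(c * y)) ≤ δ := by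
    rw [← hlog, Real.exp_neg, Real.exp_log (by positivity), ← div_eq_mul_inv,
      div_le_iff₀ (by positivity)]
    have : δ * (1 + μ / δ) = δ + μ := by field_simp
    linarith
  have h5 : (y + 1) * Real.exp (-((1 - c) * y)) ≤ 1 / (1 - c) := by
    rw [Real.exp_neg, ← div_eq_mul_inv, div_le_div_iff₀ (Real.exp_pos _) hc]
    have := Real.add_one_le_exp ((1 - c) * y)
    nlinarith
  calc μ * ((⌊y⌋₊.factorial : ℝ) * q ^ ⌊y⌋₊)
      ≤ μ * (Real.exp 1 * ((⌊y⌋₊ + 1) * Real.exp (-⌊y⌋₊))) :=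
        mul_le_mul_of_nonneg_left (factorial_mul_pow_le hq hJ) hμ.le
    _ ≤ μ * (Real.exp 1 * ((y + 1) * (Real.exp 1 * Real.exp (-y)))) := by gcongr
    _ = Real.exp 1 ^ 2 * ((y + 1) * Real.exp (-((1 - c) * y))) * (μ * Real.exp (-(c * y))) := by
        have : Real.exp (-y) = Real.exp (-((1 - c) * y)) * Real.exp (-(c * y)) := by
          rw [← Real.exp_add]; ring_nf
        rw [this]; ring
    _ ≤ Real.exp 1 ^ 2 * (1 / (1 - c)) * δ := by gcongr
    _ = _ := by ring

/-! ### The function `mLog` and its inverse -/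

theorem mLog_antitoneOn {m : ℝ → ℝ} (hm_anti : AntitoneOn m (Ioc 0 π))
    (hm_pos : ∀ ε ∈ Ioc 0 π, 0 < m ε) : AntitoneOn (mLog m) (Ioc 0 π) := by
  intro a ha b hb hab
  have h1 := hm_anti ha hb hab
  have ha0 := ha.1
  have hb0 := hb.1
  have h2 := hm_pos a ha
  have h3 := hm_pos b hb
  have h4 : 0 ≤ Real.log (1 + m b / b) := Real.log_nonneg (by linarith [div_pos h3 hb0])
  unfold mLog
  gcongr

/-- Above `mLog m π`, the value `mLogInv m t` is a preimage of `t` in `(0, π]`, and not the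
default value of `Function.invFunOn`. -/
theorem mLogInv_spec {m : ℝ → ℝ} (hm_cont : ContinuousOn m (Ioc 0 π))
    (hm_anti : AntitoneOn m (Ioc 0 π)) (hm_pos : ∀ ε ∈ Ioc 0 π, 0 < m ε) {t : ℝ}
    (ht : mLog m π ≤ t) : mLogInv m t ∈ Ioc 0 π ∧ mLog m (mLogInv m t) = t := by
  have hπ : π ∈ Ioc 0 π := ⟨Real.pi_pos, le_rfl⟩
  have hmπ := hm_pos π hπ
  -- At this `ε` the function is at least `t`, since `mLog m ε ≥ m π * log (1 + m π / ε)`.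
  set ε : ℝ := min π (m π * Real.exp (-(t / m π))) with hε
  have hε0 : 0 < ε := lt_min Real.pi_pos (by positivity)
  have hεπ : ε ≤ π := min_le_left _ _
  have hle : t ≤ mLog m ε := by
    have h1 : m π ≤ m ε := hm_anti ⟨hε0, hεπ⟩ hπ hεπ
    have h2 : Real.exp (t / m π) ≤ 1 + m ε / ε := by
      have h3 : Real.exp (t / m π) * ε ≤ m π := by
        calc Real.exp (t / m π) * ε ≤ Real.exp (t / m π) * (m π * Real.exp (-(t / m π))) := by
              gcongr; exact min_le_right _ _
          _ = m π := by rw [Real.exp_neg]; field_simp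
      have h4 : Real.exp (t / m π) ≤ m ε / ε := by
        rw [le_div_iff₀ hε0]; exact h3.trans h1
      linarith
    have h5 : t / m π ≤ Real.log (1 + m ε / ε) :=
      (Real.le_log_iff_exp_le ((Real.exp_pos _).trans_le h2)).2 h2
    have h6 : 0 ≤ Real.log (1 + m ε / ε) :=
      Real.log_nonneg (by linarith [div_pos (hmπ.trans_le h1) hε0])
    calc t = m π * (t / m π) := by field_simp
      _ ≤ m π * Real.log (1 + m ε / ε) := by gcongr
      _ ≤ m ε * Real.log (1 + m ε / ε) := by gcongr
  have hsub : Icc ε π ⊆ Ioc 0 π := fun u hu => ⟨hε0.trans_le hu.1, hu.2⟩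
  have hcont : ContinuousOn (mLog m) (Icc ε π) := by
    have hm := hm_cont.mono hsub
    refine hm.mul (ContinuousOn.log (continuousOn_const.add
      (hm.div continuousOn_id fun u hu => (hsub hu).1.ne')) fun u hu => ?_)
    have := div_pos (hm_pos u (hsub hu)) (hsub hu).1
    exact (by linarith : (0 : ℝ) < 1 + m u / u).ne'
  obtain ⟨u, hu, hut⟩ := intermediate_value_Icc' hεπ hcont ⟨ht, hle⟩
  have hex : ∃ a ∈ Ioc 0 π, mLog m a = t := ⟨u, hsub hu, hut⟩
  exact ⟨Function.invFunOn_mem hex, Function.invFunOn_eq hex⟩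

/-! ### The cutoff and the rate of decay -/

/-- The function `1 - β (θ / δ)` is an admissible cutoff in `norm_integral_cutoff_le`, with a
constant that does not depend on `δ`. -/
theorem exists_bound_one_sub_dilate {β : ℝ → ℝ} (hβ : ContDiff ℝ ∞ β) (hβc : HasCompactSupport β)
    (hβ1 : ∀ u, |u| ≤ 1 → β u = 1) (hβ2 : ∀ u, 2 ≤ |u| → β u = 0)
    (hβI : ∀ u, β u ∈ Icc (0 : ℝ) 1) :
    ∃ B : ℝ, 0 ≤ B ∧ ∀ δ : ℝ, 0 < δ → 2 * δ ≤ π →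
      ContDiff ℝ ∞ (fun θ => 1 - β (θ / δ)) ∧
      (∀ θ, |θ| < δ → 1 - β (θ / δ) = 0) ∧ (∀ θ, |1 - β (θ / δ)| ≤ 1) ∧
      1 - β (-π / δ) = 1 - β (π / δ) ∧
      (∀ θ, |deriv (fun θ => 1 - β (θ / δ)) θ| ≤ B / δ) ∧
      ∀ θ, 2 * δ ≤ |θ| → deriv (fun θ => 1 - β (θ / δ)) θ = 0 := by
  obtain ⟨B, hB⟩ := (hβ.continuous_deriv (by simp)).bounded_above_of_compact_support hβc.deriv
  have hB0 : 0 ≤ B := (norm_nonneg _).trans (hB 0)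
  refine ⟨B, hB0, fun δ hδ hδπ => ?_⟩
  have habs : ∀ θ : ℝ, |θ / δ| = |θ| / δ := fun θ => by rw [abs_div, abs_of_pos hδ]
  have hπδ : 2 ≤ |π / δ| := by
    rw [habs, le_div_iff₀ hδ, abs_of_pos Real.pi_pos]; exact hδπ
  have hderiv : ∀ θ, deriv (fun θ => 1 - β (θ / δ)) θ = -(deriv β (θ / δ) / δ) := by
    intro θ
    have h := ((hβ.differentiable (by simp)) (θ / δ)).hasDerivAt.comp θ
      ((hasDerivAt_id θ).div_const δ)
    have h' := (h.const_sub 1).deriv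
    simp only [Function.comp_def, id] at h'
    rw [h']
    ring
  refine ⟨by fun_prop, fun θ h => ?_, fun θ => ?_, ?_, fun θ => ?_, fun θ h => ?_⟩
  · rw [hβ1 _ (by rw [habs, div_le_one hδ]; exact h.le), sub_self]
  · have := hβI (θ / δ)
    rw [abs_le]
    constructor <;> linarith [this.1, this.2]
  · rw [neg_div, hβ2 _ hπδ, hβ2 _ (by rwa [abs_neg])]
  · rw [hderiv, abs_neg, abs_div, abs_of_pos hδ]
    gcongr
    exact hB _
  -- `β ≥ 0` vanishes at `θ / δ`, hence has a minimum there.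
  · rw [hderiv, IsLocalMin.deriv_eq_zero, zero_div, neg_zero]
    refine Eventually.of_forall fun u => ?_
    rw [hβ2 (θ / δ) (by rw [habs, le_div_iff₀ hδ]; exact h)]
    exact (hβI u).1

end DiscreteTauberian

open DiscreteTauberian in
theorem theorem2p4 {X : Type*} [NormedAddCommGroup X] [NormedSpace ℂ X] [CompleteSpace X]
    (x : ℕ → X) (hx : Memℓp x ∞)
    (hsum : ∃ K : ℝ, ∀ n : ℕ, ‖∑ k ∈ Finset.range (n + 1), x k‖ ≤ K)
    (F : Circle → X)
    (hF : DiscreteTauberian.IsBoundaryFunction (DiscreteTauberian.genFun x) F)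
    (hsmooth : ContMDiffOn (𝓡 1) 𝓘(ℝ, X) ((⊤ : ℕ∞) : WithTop ℕ∞) F {z : Circle | z ≠ 1})
    (m : ℝ → ℝ) (hm_cont : ContinuousOn m (Set.Ioc 0 Real.pi))
    (hm_anti : AntitoneOn m (Set.Ioc 0 Real.pi))
    (hm_pos : ∀ ε ∈ Set.Ioc 0 Real.pi, 0 < m ε)
    (hbound : ∃ C : ℝ, 0 < C ∧ ∀ (j : ℕ) (θ : ℝ), 0 < |θ| → |θ| ≤ Real.pi →
      ‖DiscreteTauberian.iteratedCircleDeriv j F (Circle.exp θ)‖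
        ≤ C * (j.factorial : ℝ) * |θ| * m |θ| ^ (j + 1))
    (c : ℝ) (hc0 : 0 < c) (hc1 : c < 1) :
    (fun n : ℕ => ‖x n‖) =O[atTop]
      (fun n : ℕ => DiscreteTauberian.mLogInv m (c * (n : ℝ))) := by
  have hπ := Real.pi_pos
  obtain ⟨K, hK⟩ := hsum
  obtain ⟨C, hC, hbound⟩ := hbound
  obtain ⟨K₁, hK₁⟩ : ∃ K₁, ∀ n, ‖x n‖ ≤ K₁ := by
    obtain ⟨K₁, h⟩ := memℓp_infty_iff.1 hx
    exact ⟨K₁, fun n => h ⟨n, rfl⟩⟩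
  obtain ⟨β, hβ, hβc, hβ1, hβ2, hβI⟩ := exists_cutoff
  obtain ⟨A, hA0, hA⟩ := exists_norm_sub_integral_le hβ hβc hβ1 hβ2 hK₁ hK hF
  obtain ⟨B, hB0, hB⟩ := exists_bound_one_sub_dilate hβ hβc hβ1 hβ2 hβI
  refine IsBigO.of_bound (A + 8 * B * C + 2 * Real.pi ^ 2 * C * (Real.exp 1 ^ 2 / (1 - c))) ?_
  have htend : Tendsto (fun n : ℕ => c * (n : ℝ)) atTop atTop :=
    tendsto_natCast_atTop_atTop.const_mul_atTop hc0
  have hπ2 : Real.pi / 2 ∈ Set.Ioc 0 Real.pi := ⟨by positivity, by linarith⟩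
  have hππ : Real.pi ∈ Set.Ioc 0 Real.pi := ⟨hπ, le_rfl⟩
  -- For these `n`, `δ = mLogInv m (c n)` is below `π / 2`, so that the cutoff fits into `[-π, π]`.
  filter_upwards [htend.eventually_gt_atTop (mLog m (Real.pi / 2))] with n hn
  obtain ⟨hδm, hδ⟩ := mLogInv_spec hm_cont hm_anti hm_pos
    ((mLog_antitoneOn hm_anti hm_pos hπ2 hππ (by linarith)).trans hn.le)
  set δ : ℝ := mLogInv m (c * (n : ℝ)) with hδdef
  have hδ0 : 0 < δ := hδm.1
  have hδπ : 2 * δ ≤ Real.pi := by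
    by_contra hcon
    have := mLog_antitoneOn hm_anti hm_pos hπ2 hδm (by linarith)
    linarith
  have hμ := hm_pos δ hδm
  obtain ⟨h1, h2, h3, h4, h5, h6⟩ := hB δ hδ0 hδπ
  have hJ : (⌊n / m δ⌋₊ : ℝ) * (m δ / (n + 1 : ℕ)) ≤ 1 := by
    have hf : (⌊n / m δ⌋₊ : ℝ) ≤ n / m δ := Nat.floor_le (by positivity)
    calc (⌊n / m δ⌋₊ : ℝ) * (m δ / (n + 1 : ℕ)) ≤ n / m δ * (m δ / (n + 1 : ℕ)) := by gcongr
      _ = n / (n + 1 : ℕ) := by field_simp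
      _ ≤ 1 := by
        rw [div_le_one (by positivity)]
        push_cast
        linarith
  have hhigh := norm_integral_cutoff_le h1 hδ0 hδπ hB0 h2 h3 h4 h5 h6 hsmooth hC.le hμ.le
    (fun j θ hθ hθπ => by
      have hθ0 := hδ0.trans_le hθ
      have := hm_anti hδm ⟨hθ0, hθπ⟩ hθ
      have := hm_pos |θ| ⟨hθ0, hθπ⟩
      refine (hbound j θ hθ0 hθπ).trans ?_
      gcongr) (Nat.succ_pos n) ⌊n / m δ⌋₊
  have hsum := sum_factorial_mul_pow_le_one (by positivity) hJ
  have hrem := remainder_le hμ hδ0 hc0 hc1 hδ (by positivity) hJ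
  have hlow := hA δ hδ0 hδπ n
  have hexp : ∀ θ : ℝ, Complex.exp (((n + 1) * θ : ℝ) * Complex.I)
      = (Circle.exp θ : ℂ) ^ (n + 1) := by
    intro θ
    rw [Circle.coe_exp, ← Complex.exp_nat_mul]
    push_cast
    ring_nf
  simp only [hexp] at hlow
  have htri : ‖(2 * Real.pi : ℂ) • x n‖ ≤ A * δ + (8 * B * C * δ * 1
      + 2 * Real.pi ^ 2 * C * (Real.exp 1 ^ 2 / (1 - c) * δ)) := by
    refine (norm_le_norm_sub_add _ _).trans (add_le_add hlow (hhigh.trans ?_))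
    gcongr
  have h2π : ‖(2 * Real.pi : ℂ) • x n‖ = 2 * Real.pi * ‖x n‖ := by
    rw [norm_smul]
    simp [abs_of_pos hπ]
  rw [norm_norm, Real.norm_of_nonneg hδ0.le]
  have h2π1 : ‖x n‖ ≤ 2 * Real.pi * ‖x n‖ :=
    le_mul_of_one_le_left (norm_nonneg _) (by linarith [Real.pi_gt_three])
  linarith
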